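/- Integer sequences are finite and nonempty. An extension of $s=s(1),\dots,s(n)$ is a sequence obtained by repeating each element of $s$ an arbitrary positive number of times. A sequence $r$ dominates $s$, written $r\prec s$, if there are extensions $r^*$ of $r$ and $s^*$ of $s$ of the same length with $r^*(i)\le s^*(i)$ for all $i$. The set $r\oplus s$ of merges of $r$ and $s$ consists of all elementwise sums $r^*+s^*$ of extensions $r^*$ of $r$ and $s^*$ of $s$ of equal length. The merge matrix of $r$ and $s$ (of lengths $m$ and $n$) is the $m\times n$ matrix $M$ with $M[i,j]=r(i)+s(j)$; a non-diagonal path in $M$ goes from $(1,1)$ to $(m,n)$ with each step from $(i,j)$ to $(i+1,j)$ or $(i,j+1)$, and the non-diagonal merges of $r$ and $s$ are the merges read off from $M$ along such paths. The typical sequence $\tau(s)$ is obtained from $s$ by exhaustively (i) deleting one of two equal consecutive elements, and (ii) deleting all elements strictly between positions $i$ and $j$, $j-i\ge 2$, whenever $s(i)\le s(k)\le s(j)$ for all $i\le k\le j$, or $s(i)\ge s(k)\ge s(j)$ for all $i\le k\le j$. The positions of $s$ that survive such a process are called typical positions; they need not be unique. Let $t\in\tau(r)\oplus\tau(s)$.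 A typical lift of $t$ is obtained as follows. Choose typical positions $a_1<\dots<a_k$ of $r$ and $b_1<\dots<b_l$ of $s$, and a non-diagonal path $p$ in the merge matrix of $\tau(r)$ and $\tau(s)$ whose sequence of entries dominates $t$. Replace each point $(i,j)$ of $p$ by $(a_i,b_j)$ in $M$, fill in the straight vertical or horizontal segment of positions of $M$ between each two consecutive points, and complete the result to a non-diagonal path of $M$ by adding positions from $(1,1)$ to $(a_1,b_1)$ and from $(a_k,b_l)$ to $(m,n)$, in each case first increasing the row index and then the column index ($M$ is constant on these two parts). The sequence of entries of $M$ along this path is the typical lift. **Lemma.** Let $r$ and $s$ be integer sequences and let $t\in\tau(r)\oplus\tau(s)$ be such that $t\prec t_0$ for every $t_0\in\tau(r)\oplus\tau(s)$. Then a typical lift of $t$ exists, and every typical lift of $t$ is a non-diagonal merge of $r$ and $s$ and dominates every merge $q\in r\oplus s$. -/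

import Mathlib

namespace MergeSeq

/-- `s` with every element repeated at least once: concatenations `s₁ ++ ⋯ ++ sₙ` of nonempty
blocks, where all entries of the `i`-th block are equal to the `i`-th element of `s`. -/
def extensions (s : List ℤ) : Set (List ℤ) :=
  {e | ∃ blocks : List (List ℤ),
    List.Forall₂ (fun b x => b ≠ [] ∧ ∀ y ∈ b, y = x) blocks s ∧ e = blocks.flatten}

/-- `r` dominates `s`: there are extensions `r'` of `r` and `s'` of `s` of the same length with
`r' ≤ s'` elementwise (`List.Forall₂` includes the equality of the lengths). -/
def Dominates (r s : List ℤ) : Prop :=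
  ∃ r' ∈ extensions r, ∃ s' ∈ extensions s, List.Forall₂ (· ≤ ·) r' s'

/-- `r` dominates every member of `S`. -/
def DominatesSet (r : List ℤ) (S : Set (List ℤ)) : Prop :=
  ∀ s ∈ S, Dominates r s

/-- The set of all merges of `r` and `s`: elementwise sums of extensions of the same length. -/
def merges (r s : List ℤ) : Set (List ℤ) :=
  {q | ∃ r' ∈ extensions r, ∃ s' ∈ extensions s,
    r'.length = s'.length ∧ q = List.zipWith (· + ·) r' s'}

/-- The entry of the merge matrix of `r` and `s` at the (zero-based) position `(i, j)`;
only used at positions inside the matrix. -/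
def entry (r s : List ℤ) (p : ℕ × ℕ) : ℤ :=
  r.getD p.1 0 + s.getD p.2 0

/-- The list of entries of the merge matrix along a list of positions. -/
def alongPath (r s : List ℤ) (p : List (ℕ × ℕ)) : List ℤ :=
  p.map (entry r s)

/-- A non-diagonal step of a path in a matrix. -/
def NonDiagStep (x y : ℕ × ℕ) : Prop :=
  y = (x.1 + 1, x.2) ∨ y = (x.1, x.2 + 1)

/-- A non-diagonal path in an `m × n` matrix (zero-based positions): it leads from `(0, 0)` to
`(m - 1, n - 1)`, and each step increases exactly one coordinate by one. -/
def IsNonDiagPath (m n : ℕ) (p : List (ℕ × ℕ)) : Prop :=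
  0 < m ∧ 0 < n ∧ p.head? = some (0, 0) ∧ p.getLast? = some (m - 1, n - 1) ∧
    List.IsChain NonDiagStep p

/-- The non-diagonal merges of `r` and `s`: the merges that are read off along a non-diagonal
path in the merge matrix. -/
def nonDiagMerges (r s : List ℤ) : Set (List ℤ) :=
  {q | q ∈ merges r s ∧ ∃ p, IsNonDiagPath r.length s.length p ∧ q = alongPath r s p}

/-- One reduction step towards the typical sequence, for a list of items with integer values
`val`. With `val = id` this is a step on integer sequences. With items the positions of a sequence,
it also records which positions survive; of two adjacent items with equal values either one may be
the survivor, which makes no difference for the sequence of values. -/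
inductive TypicalStep {α : Type} (val : α → ℤ) : List α → List α → Prop
  /-- removal of a consecutive repetition, the first copy is kept -/
  | keepFirst (a b : List α) (x y : α) (h : val x = val y) :
      TypicalStep val (a ++ x :: y :: b) (a ++ x :: b)
  /-- removal of a consecutive repetition, the second copy is kept -/
  | keepSecond (a b : List α) (x y : α) (h : val x = val y) :
      TypicalStep val (a ++ x :: y :: b) (a ++ y :: b)
  /-- typical operation, first item minimum and last item maximum of the segment -/
  | up (a mid b : List α) (x y : α) (hmid : mid ≠ [])
      (h : ∀ z ∈ mid, val x ≤ val z ∧ val z ≤ val y) :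
      TypicalStep val (a ++ x :: (mid ++ y :: b)) (a ++ x :: y :: b)
  /-- typical operation, first item maximum and last item minimum of the segment -/
  | down (a mid b : List α) (x y : α) (hmid : mid ≠ [])
      (h : ∀ z ∈ mid, val y ≤ val z ∧ val z ≤ val x) :
      TypicalStep val (a ++ x :: (mid ++ y :: b)) (a ++ x :: y :: b)

/-- `l'` results from `l` by an exhaustive application of the reduction steps. -/
def IsTypicalReduct {α : Type} (val : α → ℤ) (l l' : List α) : Prop :=
  Relation.ReflTransGen (TypicalStep val) l l' ∧ ∀ l'', ¬ TypicalStep val l' l''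

/-- `u` is the typical sequence of `s`. -/
def IsTypicalSeq (s u : List ℤ) : Prop :=
  IsTypicalReduct id s u

/-- `I` is an (increasing) list of positions of `s` that survive an exhaustive application of the
reduction steps to `s`; the elements of `s` at these positions form the typical sequence. -/
def IsTypicalIndices (s : List ℤ) (I : List ℕ) : Prop :=
  IsTypicalReduct (fun i => s.getD i 0) (List.range s.length) I

/-- The positions strictly after `x` up to and including `y`, first increasing the row index and
then the column index. If `x` and `y` share a column (row) this is the straight segment
`(x.1 + 1, y.2), …, (y.1, y.2)` (respectively `(x.1, x.2 + 1), …, (x.1, y.2)`). -/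
def segment (x y : ℕ × ℕ) : List (ℕ × ℕ) :=
  (List.range' (x.1 + 1) (y.1 - x.1)).map (fun i => (i, x.2)) ++
    (List.range' (x.2 + 1) (y.2 - x.2)).map (fun j => (y.1, j))

/-- Starting after `x`, run through the given corner points, filling in the segments. -/
def connect : ℕ × ℕ → List (ℕ × ℕ) → List (ℕ × ℕ)
  | _, [] => []
  | x, y :: l => segment x y ++ connect y l

/-- The path in an `m × n` matrix obtained from a path `p` in its submatrix with rows `I` and
columns `J` by filling in the segments between consecutive points of `p`, and those from `(0, 0)`
to the first point and from the last point to `(m - 1, n - 1)`. For typical indices of two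
sequences, the merge matrix is constant along the latter two segments (which are empty if the
first and the last positions are among the chosen ones). -/
def liftPath (m n : ℕ) (I J : List ℕ) (p : List (ℕ × ℕ)) : List (ℕ × ℕ) :=
  (0, 0) :: connect (0, 0) (p.map (fun x => (I.getD x.1 0, J.getD x.2 0)) ++ [(m - 1, n - 1)])

/-- `L` is a typical lift of the merge `t` of the typical sequences `u` of `r` and `v` of `s`:
choose positions `I`, `J` of `r`, `s` inducing `u`, `v`, choose a non-diagonal path `p` in the merge
matrix of `u` and `v` that dominates `t`, and read off the merge matrix of `r` and `s` along the path
obtained from `p` by filling in the rows and columns between the chosen positions. -/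
def IsTypicalLift (r s u v t L : List ℤ) : Prop :=
  ∃ I J : List ℕ, ∃ p : List (ℕ × ℕ),
    IsTypicalIndices r I ∧ I.map (fun i => r.getD i 0) = u ∧
    IsTypicalIndices s J ∧ J.map (fun j => s.getD j 0) = v ∧
    IsNonDiagPath u.length v.length p ∧ Dominates (alongPath u v p) t ∧
    L = alongPath r s (liftPath r.length s.length I J p)

end MergeSeq

namespace MergeSeq

/-! Domination is a preorder, and any typical lift `L` is placed at the left end of a chain of
dominations: `L`, the entries along the path `p` for the typical sequences, `t`, a merge `q'` of the
typical sequences, the given merge `q`. The second link belongs to the definition of a lift and the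
third is the hypothesis on `t`.

The last link (`exists_merge_typicalSeq`) holds because every reduction step yields a dominating
sequence, and replacing a summand of a merge by a dominating sequence yields a dominating merge
(`WalkDominates.exists_walkMerge`).

The first link (`liftPath_spec`) rests on an invariant of the reduction, `BoundedByNeighbor`: a
deleted value never exceeds the value at one of its nearest surviving positions. Along a filled-in
segment one coordinate is fixed, so its entries are at most the larger of the entries at its ends
and can be matched with that end.

For existence, reductions of values are traced on positions, and the diagonal steps of `t` are
replaced by cheap detours (`WalkMerge.exists_isNonDiagPath`).

Extensions are traded throughout for walks with two pointers, where in each step at least one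
pointer moves; this makes induction possible. -/

/-! ### Extensions -/

/-- Inductive description of `extensions`. -/
inductive IsExtension : List ℤ → List ℤ → Prop
  | nil : IsExtension [] []
  | cons {x : ℤ} {s e : List ℤ} : IsExtension s e → IsExtension (x :: s) (x :: e)
  | dup {x : ℤ} {s e : List ℤ} : IsExtension (x :: s) e → IsExtension (x :: s) (x :: e)

theorem isExtension_of_mem_extensions {s e : List ℤ} (h : e ∈ extensions s) :
    IsExtension s e := by
  obtain ⟨blocks, hb, rfl⟩ := h
  induction hb with
  | nil => exact .nil
  | @cons b x bs s hbx _ ih =>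
    obtain ⟨hne, hall⟩ := hbx
    induction b with
    | nil => exact absurd rfl hne
    | cons y b ihb =>
      obtain rfl : y = x := hall y (by simp)
      rcases eq_or_ne b [] with rfl | hb
      · exact .cons ih
      · exact .dup (ihb hb fun z hz => hall z (List.mem_cons_of_mem _ hz))

theorem IsExtension.mem_extensions {s e : List ℤ} (h : IsExtension s e) : e ∈ extensions s := by
  induction h with
  | nil => exact ⟨[], .nil, rfl⟩
  | @cons x s e _ ih =>
    obtain ⟨bs, hbs, rfl⟩ := ih
    exact ⟨[x] :: bs, .cons (by simp) hbs, rfl⟩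
  | @dup x s e _ ih =>
    obtain ⟨bs, hbs, rfl⟩ := ih
    cases hbs with
    | @cons b _ bs _ hb hbs =>
      refine ⟨(x :: b) :: bs, .cons ⟨by simp, ?_⟩ hbs, rfl⟩
      simpa using hb.2

/-! ### Domination -/

/-- Inductive description of `Dominates`: a monotone walk through both sequences. -/
inductive WalkDominates : List ℤ → List ℤ → Prop
  | nil : WalkDominates [] []
  | both {a b : ℤ} {r s : List ℤ} : a ≤ b → WalkDominates r s → WalkDominates (a :: r) (b :: s)
  | left {a b : ℤ} {r s : List ℤ} :
      a ≤ b → WalkDominates r (b :: s) → WalkDominates (a :: r) (b :: s)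
  | right {a b : ℤ} {r s : List ℤ} :
      a ≤ b → WalkDominates (a :: r) s → WalkDominates (a :: r) (b :: s)

theorem walkDominates_of_isExtension {r' s' : List ℤ} (h : List.Forall₂ (· ≤ ·) r' s') :
    ∀ {r s : List ℤ}, IsExtension r r' → IsExtension s s' → WalkDominates r s := by
  induction h with
  | nil =>
    intro r s hr hs
    cases hr; cases hs; exact .nil
  | cons hab _ ih =>
    intro r s hr hs
    cases hr with
    | cons hr =>
      cases hs with
      | cons hs => exact .both hab (ih hr hs)
      | dup hs => exact .left hab (ih hr hs)
    | dup hr =>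
      cases hs with
      | cons hs => exact .right hab (ih hr hs)
      | dup hs => exact ih hr hs

theorem WalkDominates.exists_extensions {r s : List ℤ} (h : WalkDominates r s) :
    ∃ r' s', IsExtension r r' ∧ IsExtension s s' ∧ List.Forall₂ (· ≤ ·) r' s' := by
  induction h with
  | nil => exact ⟨[], [], .nil, .nil, .nil⟩
  | both hab _ ih =>
    obtain ⟨r', s', hr, hs, h⟩ := ih
    exact ⟨_, _, .cons hr, .cons hs, .cons hab h⟩
  | left hab _ ih =>
    obtain ⟨r', s', hr, hs, h⟩ := ih
    exact ⟨_, _, .cons hr, .dup hs, .cons hab h⟩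
  | right hab _ ih =>
    obtain ⟨r', s', hr, hs, h⟩ := ih
    exact ⟨_, _, .dup hr, .cons hs, .cons hab h⟩

theorem dominates_iff_walkDominates {r s : List ℤ} : Dominates r s ↔ WalkDominates r s := by
  constructor
  · rintro ⟨r', hr, s', hs, h⟩
    exact walkDominates_of_isExtension h (isExtension_of_mem_extensions hr)
      (isExtension_of_mem_extensions hs)
  · intro h
    obtain ⟨r', s', hr, hs, h⟩ := h.exists_extensions
    exact ⟨r', hr.mem_extensions, s', hs.mem_extensions, h⟩

namespace WalkDominates

theorem refl : ∀ r : List ℤ, WalkDominates r r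
  | [] => .nil
  | _ :: r => .both le_rfl (refl r)

/-- The two walks are synchronized on their common pointer in `s`: a walk that is about to leave the
current element of `s` waits until the other one leaves it too. -/
theorem trans {r s t : List ℤ} (h₁ : WalkDominates r s) (h₂ : WalkDominates s t) :
    WalkDominates r t := by
  match h₁, h₂ with
  | .nil, .nil => exact .nil
  | .left hab h₁, .both hbc h₂ => exact .left (hab.trans hbc) (trans h₁ (.both hbc h₂))
  | .left hab h₁, .left hbc h₂ => exact .left (hab.trans hbc) (trans h₁ (.left hbc h₂))
  | .left hab h₁, .right hbc h₂ => exact .left (hab.trans hbc) (trans h₁ (.right hbc h₂))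
  | .both hab h₁, .both hbc h₂ => exact .both (hab.trans hbc) (trans h₁ h₂)
  | .both hab h₁, .left hbc h₂ => exact .left (hab.trans hbc) (trans h₁ h₂)
  | .both hab h₁, .right hbc h₂ => exact .right (hab.trans hbc) (trans (.both hab h₁) h₂)
  | .right hab h₁, .both hbc h₂ => exact .right (hab.trans hbc) (trans h₁ h₂)
  -- Only the pointer in the middle sequence moves here, so the composed walk makes no step.
  | .right hab h₁, .left hbc h₂ => exact trans h₁ h₂
  | .right hab h₁, .right hbc h₂ => exact .right (hab.trans hbc) (trans (.right hab h₁) h₂)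
termination_by r.length + s.length + t.length

theorem append_left {r s : List ℤ} (h : WalkDominates r s) :
    ∀ a : List ℤ, WalkDominates (a ++ r) (a ++ s)
  | [] => h
  | _ :: a => .both le_rfl (append_left h a)

theorem prepend_le {c : ℤ} {r s : List ℤ} (h : WalkDominates r (c :: s)) :
    ∀ {a : List ℤ}, (∀ z ∈ a, z ≤ c) → WalkDominates (a ++ r) (c :: s)
  | [], _ => h
  | z :: _, ha =>
    .left (ha z (by simp)) (prepend_le h fun w hw => ha w (List.mem_cons_of_mem _ hw))

theorem append_le {c : ℤ} {r s : List ℤ} (h : WalkDominates (c :: r) s) :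
    ∀ {a : List ℤ}, (∀ z ∈ a, c ≤ z) → WalkDominates (c :: r) (a ++ s)
  | [], _ => h
  | z :: _, ha =>
    .right (ha z (by simp)) (append_le h fun w hw => ha w (List.mem_cons_of_mem _ hw))

theorem cons_append_le {c d : ℤ} {r s : List ℤ} (h : WalkDominates r s) (hd : c ≤ d) :
    ∀ {a : List ℤ}, (∀ z ∈ a, c ≤ z) → WalkDominates (c :: r) (d :: (a ++ s))
  | [], _ => .both hd h
  | z :: _, ha =>
    .right hd (cons_append_le h (ha z (by simp)) fun w hw => ha w (List.mem_cons_of_mem _ hw))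

end WalkDominates

/-! ### Merges -/

/-- Inductive description of `merges`: a monotone walk through both sequences. -/
inductive WalkMerge : List ℤ → List ℤ → List ℤ → Prop
  | nil : WalkMerge [] [] []
  | both {x y : ℤ} {r s q : List ℤ} :
      WalkMerge r s q → WalkMerge (x :: r) (y :: s) ((x + y) :: q)
  | left {x y : ℤ} {r s q : List ℤ} :
      WalkMerge r (y :: s) q → WalkMerge (x :: r) (y :: s) ((x + y) :: q)
  | right {x y : ℤ} {r s q : List ℤ} :
      WalkMerge (x :: r) s q → WalkMerge (x :: r) (y :: s) ((x + y) :: q)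

theorem WalkMerge.mem_merges {r s q : List ℤ} (h : WalkMerge r s q) : q ∈ merges r s := by
  suffices ∃ r' s', IsExtension r r' ∧ IsExtension s s' ∧ r'.length = s'.length ∧
      q = List.zipWith (· + ·) r' s' by
    obtain ⟨r', s', hr, hs, h⟩ := this
    exact ⟨r', hr.mem_extensions, s', hs.mem_extensions, h⟩
  induction h with
  | nil => exact ⟨[], [], .nil, .nil, rfl, rfl⟩
  | both _ ih =>
    obtain ⟨r', s', hr, hs, hl, rfl⟩ := ih
    exact ⟨_, _, .cons hr, .cons hs, by simpa using hl, rfl⟩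
  | left _ ih =>
    obtain ⟨r', s', hr, hs, hl, rfl⟩ := ih
    exact ⟨_, _, .cons hr, .dup hs, by simpa using hl, rfl⟩
  | right _ ih =>
    obtain ⟨r', s', hr, hs, hl, rfl⟩ := ih
    exact ⟨_, _, .dup hr, .cons hs, by simpa using hl, rfl⟩

/-- A walk that rests in both sequences yields a merge only up to domination. -/
theorem exists_walkMerge_of_isExtension {r' : List ℤ} :
    ∀ {r s s' : List ℤ}, IsExtension r r' → IsExtension s s' → r'.length = s'.length →
      ∃ q, WalkMerge r s q ∧ WalkDominates q (List.zipWith (· + ·) r' s') := by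
  induction r' with
  | nil =>
    intro r s s' hr hs hl
    obtain rfl : s' = [] := List.length_eq_zero_iff.1 hl.symm
    cases hr; cases hs
    exact ⟨[], .nil, .nil⟩
  | cons x r' ih =>
    intro r s s' hr hs hl
    cases hr with
    | cons hr =>
      cases hs with
      | nil => simp at hl
      | cons hs =>
        obtain ⟨q, hq, hd⟩ := ih hr hs (by simpa using hl)
        exact ⟨_, .both hq, .both le_rfl hd⟩
      | dup hs =>
        obtain ⟨q, hq, hd⟩ := ih hr hs (by simpa using hl)
        exact ⟨_, .left hq, .both le_rfl hd⟩
    | dup hr =>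
      cases hs with
      | nil => simp at hl
      | cons hs =>
        obtain ⟨q, hq, hd⟩ := ih hr hs (by simpa using hl)
        exact ⟨_, .right hq, .both le_rfl hd⟩
      | dup hs =>
        obtain ⟨q, hq, hd⟩ := ih hr hs (by simpa using hl)
        refine ⟨q, hq, ?_⟩
        cases hq <;> exact .right le_rfl hd

theorem exists_walkMerge_of_mem_merges {r s q : List ℤ} (h : q ∈ merges r s) :
    ∃ q', WalkMerge r s q' ∧ WalkDominates q' q := by
  obtain ⟨r', hr, s', hs, hl, rfl⟩ := h
  exact exists_walkMerge_of_isExtension (isExtension_of_mem_extensions hr)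
    (isExtension_of_mem_extensions hs) hl

theorem WalkMerge.symm {r s q : List ℤ} (h : WalkMerge r s q) : WalkMerge s r q := by
  induction h with
  | nil => exact .nil
  | both _ ih => rw [add_comm]; exact .both ih
  | left _ ih => rw [add_comm]; exact .right ih
  | right _ ih => rw [add_comm]; exact .left ih

/-- The walk for `u` and `r` is synchronized with the merge along their common pointer in `r`; the
element of `u` then stands in for the element of `r` that it is matched with. -/
theorem WalkDominates.exists_walkMerge {u r s q : List ℤ} (h : WalkDominates u r)
    (hq : WalkMerge r s q) : ∃ q', WalkMerge u s q' ∧ WalkDominates q' q := by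
  match h, hq with
  | .nil, .nil => exact ⟨[], .nil, .nil⟩
  | .left hab h, .both hq =>
    obtain ⟨q', hq', hd⟩ := exists_walkMerge h (.both hq)
    exact ⟨_, .left hq', .left (by gcongr) hd⟩
  | .left hab h, .left hq =>
    obtain ⟨q', hq', hd⟩ := exists_walkMerge h (.left hq)
    exact ⟨_, .left hq', .left (by gcongr) hd⟩
  | .left hab h, .right hq =>
    obtain ⟨q', hq', hd⟩ := exists_walkMerge h (.right hq)
    exact ⟨_, .left hq', .left (by gcongr) hd⟩
  | .both hab h, .both hq =>
    obtain ⟨q', hq', hd⟩ := exists_walkMerge h hq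
    exact ⟨_, .both hq', .both (by gcongr) hd⟩
  | .both hab h, .left hq =>
    obtain ⟨q', hq', hd⟩ := exists_walkMerge h hq
    exact ⟨_, .left hq', .both (by gcongr) hd⟩
  | .both hab h, .right hq =>
    obtain ⟨q', hq', hd⟩ := exists_walkMerge (.both hab h) hq
    exact ⟨_, .right hq', .both (by gcongr) hd⟩
  | .right hab h, .both hq =>
    obtain ⟨q', hq', hd⟩ := exists_walkMerge h hq
    exact ⟨_, .right hq', .both (by gcongr) hd⟩
  | .right hab h, .left hq =>
    obtain ⟨q', hq', hd⟩ := exists_walkMerge h hq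
    refine ⟨q', hq', ?_⟩
    -- Neither `u` nor `s` advances, so no entry is added. The first entry of `q'` is the sum of the
    -- current elements of `u` and `s`, and it also covers the additional entry of `q`.
    cases hq' <;> exact .right (by gcongr) hd
  | .right hab h, .right hq =>
    obtain ⟨q', hq', hd⟩ := exists_walkMerge (.right hab h) hq
    exact ⟨_, .right hq', .both (by gcongr) hd⟩
termination_by u.length + r.length + s.length

/-! ### Non-diagonal paths -/

theorem IsNonDiagPath.exists_eq_cons {m n : ℕ} {p : List (ℕ × ℕ)} (h : IsNonDiagPath m n p) :
    ∃ p', p = (0, 0) :: p' := by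
  obtain ⟨_, _, h0, _⟩ := h
  cases p with
  | nil => simp at h0
  | cons a p => exact ⟨p, by simpa using h0⟩

theorem isNonDiagPath_one : IsNonDiagPath 1 1 [(0, 0)] := by
  simp [IsNonDiagPath]

theorem IsNonDiagPath.cons_left {m n : ℕ} {p : List (ℕ × ℕ)} (h : IsNonDiagPath m n p) :
    IsNonDiagPath (m + 1) n ((0, 0) :: p.map fun x => (x.1 + 1, x.2)) := by
  obtain ⟨hm, hn, h0, hl, hc⟩ := h
  refine ⟨by omega, by omega, rfl, ?_, ?_⟩
  · rw [List.getLast?_cons, List.getLast?_map, hl]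
    simp; omega
  · refine List.isChain_cons.2 ⟨?_, (List.isChain_map _).2 (hc.imp ?_)⟩
    · simp [h0, NonDiagStep]
    · rintro x y (rfl | rfl) <;> simp [NonDiagStep]

theorem IsNonDiagPath.cons_right {m n : ℕ} {p : List (ℕ × ℕ)} (h : IsNonDiagPath m n p) :
    IsNonDiagPath m (n + 1) ((0, 0) :: p.map fun x => (x.1, x.2 + 1)) := by
  obtain ⟨hm, hn, h0, hl, hc⟩ := h
  refine ⟨by omega, by omega, rfl, ?_, ?_⟩
  · rw [List.getLast?_cons, List.getLast?_map, hl]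
    simp; omega
  · refine List.isChain_cons.2 ⟨?_, (List.isChain_map _).2 (hc.imp ?_)⟩
    · simp [h0, NonDiagStep]
    · rintro x y (rfl | rfl) <;> simp [NonDiagStep]

theorem alongPath_cons_left (x y : ℤ) (r s : List ℤ) (p : List (ℕ × ℕ)) :
    alongPath (x :: r) (y :: s) ((0, 0) :: p.map fun x => (x.1 + 1, x.2)) =
      (x + y) :: alongPath r (y :: s) p := by
  simp [alongPath, entry]

theorem alongPath_cons_right (x y : ℤ) (r s : List ℤ) (p : List (ℕ × ℕ)) :
    alongPath (x :: r) (y :: s) ((0, 0) :: p.map fun x => (x.1, x.2 + 1)) =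
      (x + y) :: alongPath (x :: r) s p := by
  simp [alongPath, entry]

/-- Diagonal steps of a merge can be avoided: one of the two detours never exceeds the larger
endpoint of the step. -/
theorem WalkMerge.exists_isNonDiagPath {r s q : List ℤ} (h : WalkMerge r s q) (hr : r ≠ []) :
    ∃ p, IsNonDiagPath r.length s.length p ∧ WalkDominates (alongPath r s p) q := by
  induction h with
  | nil => exact absurd rfl hr
  | @left x y r s q h ih =>
    obtain ⟨p, hp, hd⟩ := ih (by cases h <;> simp)
    exact ⟨_, hp.cons_left, by rw [alongPath_cons_left]; exact .both le_rfl hd⟩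
  | @right x y r s q h ih =>
    obtain ⟨p, hp, hd⟩ := ih (by simp)
    exact ⟨_, hp.cons_right, by rw [alongPath_cons_right]; exact .both le_rfl hd⟩
  | @both x y r s q h ih =>
    cases r with
    | nil =>
      cases h
      exact ⟨_, isNonDiagPath_one, .both (by simp [entry]) .nil⟩
    | cons x' r =>
      obtain ⟨p, hp, hd⟩ := ih (by simp)
      obtain ⟨y', s, rfl⟩ : ∃ y' s', s = y' :: s' := by cases h <;> exact ⟨_, _, rfl⟩
      obtain ⟨q', rfl⟩ : ∃ q', q = (x' + y') :: q' := by cases h <;> exact ⟨_, rfl⟩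
      -- The intermediate entry `c` of a detour is matched with whichever end of the diagonal step
      -- is at least `c`.
      have key : ∀ {c : ℤ}, c ≤ x + y ∨ c ≤ x' + y' →
          WalkDominates ((x + y) :: c :: alongPath (x' :: r) (y' :: s) p)
            ((x + y) :: (x' + y') :: q') := by
        rintro c (hc | hc)
        · exact .left le_rfl (.both hc hd)
        · exact .both le_rfl (.left hc hd)
      by_cases hc : x' + y ≤ x + y ∨ x' + y ≤ x' + y'
      · refine ⟨_, hp.cons_right.cons_left, ?_⟩
        rw [alongPath_cons_left, alongPath_cons_right]
        exact key hc
      · refine ⟨_, hp.cons_left.cons_right, ?_⟩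
        rw [alongPath_cons_right, alongPath_cons_left]
        -- The two detour entries have the same sum as the two ends, so if one exceeds both ends,
        -- the other lies below both.
        exact key (by omega)

/-- Stated for paths with an arbitrary start and the matching suffixes, so that induction runs back
from the last corner; the bounds at the start follow since coordinates only increase along the path.
-/
theorem walkMerge_drop_of_isChain (r s : List ℤ) (hr : r ≠ []) (hs : s ≠ []) :
    ∀ (p : List (ℕ × ℕ)) (x : ℕ × ℕ), List.IsChain NonDiagStep (x :: p) →
      (x :: p).getLast? = some (r.length - 1, s.length - 1) →
      x.1 < r.length ∧ x.2 < s.length ∧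
        WalkMerge (r.drop x.1) (s.drop x.2) (alongPath r s (x :: p)) := by
  have hr' := List.length_pos_iff.2 hr
  have hs' := List.length_pos_iff.2 hs
  intro p
  induction p with
  | nil =>
    intro x _ hl
    obtain rfl : x = (r.length - 1, s.length - 1) := by simpa using hl
    refine ⟨by simp; omega, by simp; omega, ?_⟩
    have h1 : r.length - 1 < r.length := by omega
    have h2 : s.length - 1 < s.length := by omega
    rw [List.drop_eq_getElem_cons h1, List.drop_eq_getElem_cons h2, List.drop_of_length_le,
      List.drop_of_length_le]
    · simpa [alongPath, entry, h1, h2] using WalkMerge.both (x := r[r.length - 1])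
        (y := s[s.length - 1]) .nil
    · omega
    · omega
  | cons y p ih =>
    intro x hc hl
    rw [List.isChain_cons_cons] at hc
    rw [List.getLast?_cons_cons] at hl
    obtain ⟨h1, h2, hm⟩ := ih y hc.2 hl
    rcases hc.1 with rfl | rfl
    · have h3 : x.1 < r.length := by simp at h1; omega
      refine ⟨h3, h2, ?_⟩
      have h2 : x.2 < s.length := h2
      have he : alongPath r s (x :: (x.1 + 1, x.2) :: p) =
          (r[x.1] + s[x.2]) :: alongPath r s ((x.1 + 1, x.2) :: p) := by
        simp [alongPath, entry, h2, h3]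
      rw [he, List.drop_eq_getElem_cons h3, List.drop_eq_getElem_cons h2]
      exact .left (by rwa [← List.drop_eq_getElem_cons h2])
    · have h3 : x.2 < s.length := by simp at h2; omega
      refine ⟨h1, h3, ?_⟩
      have h1 : x.1 < r.length := h1
      have he : alongPath r s (x :: (x.1, x.2 + 1) :: p) =
          (r[x.1] + s[x.2]) :: alongPath r s ((x.1, x.2 + 1) :: p) := by
        simp [alongPath, entry, h1, h3]
      rw [he, List.drop_eq_getElem_cons h3, List.drop_eq_getElem_cons h1]
      exact .right (by rwa [← List.drop_eq_getElem_cons h1])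

theorem IsNonDiagPath.alongPath_mem_nonDiagMerges {r s : List ℤ} {p : List (ℕ × ℕ)}
    (h : IsNonDiagPath r.length s.length p) : alongPath r s p ∈ nonDiagMerges r s := by
  refine ⟨?_, p, h, rfl⟩
  obtain ⟨p', rfl⟩ := h.exists_eq_cons
  obtain ⟨hr, hs, _, hl, hc⟩ := h
  exact (walkMerge_drop_of_isChain r s (List.length_pos_iff.1 hr) (List.length_pos_iff.1 hs) p' _
    hc hl).2.2.mem_merges

/-! ### Reduction steps -/

/-- In a typical operation the smaller end of the segment is at most every deleted element, so the
pointer rests on it while they pass. -/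
theorem TypicalStep.walkDominates {l l' : List ℤ} (h : TypicalStep id l l') :
    WalkDominates l' l := by
  cases h with
  | keepFirst a b x y h =>
    exact .append_left (.right le_rfl (.both (le_of_eq h) (.refl b))) a
  | keepSecond a b x y h =>
    exact .append_left (.right (le_of_eq h.symm) (.refl _)) a
  | up a mid b x y _ h =>
    exact .append_left (.cons_append_le (.refl _) le_rfl fun z hz => (h z hz).1) a
  | down a mid b x y _ h =>
    exact .append_left (.both le_rfl (.append_le (.refl _) fun z hz => (h z hz).1)) a

theorem walkDominates_of_reflTransGen {l l' : List ℤ}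
    (h : Relation.ReflTransGen (TypicalStep id) l l') : WalkDominates l' l := by
  induction h with
  | refl => exact .refl _
  | tail _ h ih => exact h.walkDominates.trans ih

theorem TypicalStep.ne_nil {α : Type} {val : α → ℤ} {l l' : List α} (h : TypicalStep val l l') :
    l' ≠ [] := by
  cases h <;> simp

theorem TypicalStep.sublist {α : Type} {val : α → ℤ} {l l' : List α}
    (h : TypicalStep val l l') : l'.Sublist l := by
  cases h with
  | keepFirst a b x y h => simp
  | keepSecond a b x y h => simp
  | up a mid b x y _ h => simp
  | down a mid b x y _ h => simp

theorem TypicalStep.map {α : Type} {val : α → ℤ} {l l' : List α} (h : TypicalStep val l l') :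
    TypicalStep id (l.map val) (l'.map val) := by
  cases h with
  | keepFirst a b x y h => simpa using TypicalStep.keepFirst (val := id) _ _ _ _ h
  | keepSecond a b x y h => simpa using TypicalStep.keepSecond (val := id) _ _ _ _ h
  | up a mid b x y hm h =>
    simpa using TypicalStep.up (val := id) (a.map val) (mid.map val) (b.map val) (val x) (val y)
      (by simpa using hm) (by simpa using h)
  | down a mid b x y hm h =>
    simpa using TypicalStep.down (val := id) (a.map val) (mid.map val) (b.map val) (val x) (val y)
      (by simpa using hm) (by simpa using h)

/-- Whether a step applies depends on values only, so it can be replayed on the positions carrying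
them. -/
theorem TypicalStep.exists_of_map {α : Type} {val : α → ℤ} {l : List α} {w : List ℤ}
    (h : TypicalStep id (l.map val) w) : ∃ l', TypicalStep val l l' ∧ l'.map val = w := by
  generalize hk : l.map val = k at h
  cases h with
  | keepFirst a b x y h =>
    simp only [List.map_eq_append_iff, List.map_eq_cons_iff] at hk
    obtain ⟨a, _, rfl, rfl, x, _, rfl, rfl, y, b, rfl, rfl, rfl⟩ := hk
    exact ⟨_, .keepFirst a b x y h, by simp⟩
  | keepSecond a b x y h =>
    simp only [List.map_eq_append_iff, List.map_eq_cons_iff] at hk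
    obtain ⟨a, _, rfl, rfl, x, _, rfl, rfl, y, b, rfl, rfl, rfl⟩ := hk
    exact ⟨_, .keepSecond a b x y h, by simp⟩
  | up a mid b x y hm h =>
    simp only [List.map_eq_append_iff, List.map_eq_cons_iff] at hk
    obtain ⟨a, _, rfl, rfl, x, _, rfl, rfl, mid, _, rfl, rfl, y, b, rfl, rfl, rfl⟩ := hk
    exact ⟨_, .up a mid b x y (by simpa using hm) (by simpa using h), by simp⟩
  | down a mid b x y hm h =>
    simp only [List.map_eq_append_iff, List.map_eq_cons_iff] at hk
    obtain ⟨a, _, rfl, rfl, x, _, rfl, rfl, mid, _, rfl, rfl, y, b, rfl, rfl, rfl⟩ := hk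
    exact ⟨_, .down a mid b x y (by simpa using hm) (by simpa using h), by simp⟩

theorem exists_reflTransGen_of_map {α : Type} {val : α → ℤ} {l : List α} {w : List ℤ}
    (h : Relation.ReflTransGen (TypicalStep id) (l.map val) w) :
    ∃ l', Relation.ReflTransGen (TypicalStep val) l l' ∧ l'.map val = w := by
  induction h with
  | refl => exact ⟨l, .refl, rfl⟩
  | tail _ h ih =>
    obtain ⟨l₁, h₁, rfl⟩ := ih
    obtain ⟨l₂, h₂, rfl⟩ := h.exists_of_map
    exact ⟨l₂, h₁.tail h₂, rfl⟩

theorem map_getD_range (s : List ℤ) : (List.range s.length).map (fun i => s.getD i 0) = s := by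
  apply List.ext_getElem <;> simp +contextual

theorem IsTypicalSeq.exists_isTypicalIndices {s u : List ℤ} (h : IsTypicalSeq s u) :
    ∃ I, IsTypicalIndices s I ∧ I.map (fun i => s.getD i 0) = u := by
  obtain ⟨h, hn⟩ := h
  rw [← map_getD_range s] at h
  obtain ⟨I, hI, rfl⟩ := exists_reflTransGen_of_map h
  exact ⟨I, ⟨hI, fun _ h' => hn _ h'.map⟩, rfl⟩

theorem IsTypicalSeq.ne_nil {s u : List ℤ} (h : IsTypicalSeq s u) (hs : s ≠ []) : u ≠ [] := by
  rcases Relation.ReflTransGen.cases_tail h.1 with rfl | ⟨_, _, h⟩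
  · exact hs
  · exact h.ne_nil

/-! ### Positions between surviving positions -/

/-- The value at every position is bounded by that at the nearest position of `I` on one side. -/
def BoundedByNeighbor (f : ℕ → ℤ) (n : ℕ) (I : List ℕ) : Prop :=
  ∀ i < n, ∃ a ∈ I, f i ≤ f a ∧ ((a ≤ i ∧ ∀ c ∈ I, c ≤ a ∨ i < c) ∨ (i ≤ a ∧ ∀ c ∈ I, c < i ∨ a ≤ c))

/-- If the witness `d` is deleted, it is replaced by the surviving copy or by the larger end of the
segment. That item is at least as large, and no survivor separates it from `i`. -/
theorem TypicalStep.boundedByNeighbor {f : ℕ → ℤ} {n : ℕ} {l l' : List ℕ}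
    (h : TypicalStep f l l') (hl : l.Pairwise (· < ·)) (hb : BoundedByNeighbor f n l) :
    BoundedByNeighbor f n l' := by
  intro i hi
  obtain ⟨d, hd, hfd, hdi⟩ := hb i hi
  by_cases hd' : d ∈ l'
  · have hs := h.sublist.subset
    refine ⟨d, hd', hfd, ?_⟩
    rcases hdi with ⟨h1, h2⟩ | ⟨h1, h2⟩
    · exact .inl ⟨h1, fun c hc => h2 c (hs hc)⟩
    · exact .inr ⟨h1, fun c hc => h2 c (hs hc)⟩
  cases h with
  | keepFirst a b x y h =>
    simp only [List.pairwise_append, List.pairwise_cons, List.mem_append, List.mem_cons] at *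
    have hax : ∀ c ∈ a, c < x := fun c hc => hl.2.2 c hc x (.inl rfl)
    refine ⟨x, by simp, ?_⟩
    grind
  | keepSecond a b x y h =>
    simp only [List.pairwise_append, List.pairwise_cons, List.mem_append, List.mem_cons] at *
    refine ⟨y, by simp, ?_⟩
    grind
  | up a mid b x y _ h =>
    simp only [List.pairwise_append, List.pairwise_cons, List.mem_append, List.mem_cons] at *
    refine ⟨y, by simp, ?_⟩
    grind
  | down a mid b x y _ h =>
    simp only [List.pairwise_append, List.pairwise_cons, List.mem_append, List.mem_cons] at *
    refine ⟨x, by simp, ?_⟩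
    grind

theorem sublist_and_boundedByNeighbor_of_reflTransGen {f : ℕ → ℤ} {n : ℕ} {I : List ℕ}
    (h : Relation.ReflTransGen (TypicalStep f) (List.range n) I) :
    I.Sublist (List.range n) ∧ BoundedByNeighbor f n I := by
  induction h with
  | refl => exact ⟨.refl _, fun i hi => ⟨i, by simpa using hi, le_rfl, by grind⟩⟩
  | tail _ h ih =>
    exact ⟨h.sublist.trans ih.1, h.boundedByNeighbor (List.pairwise_lt_range.sublist ih.1) ih.2⟩

theorem sublist_range_boundedByNeighbor (s : List ℤ) (I : List ℕ) (h : IsTypicalIndices s I) :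
    I.Pairwise (· < ·) ∧ (∀ i ∈ I, i < s.length) ∧
      BoundedByNeighbor (fun i => s.getD i 0) s.length I := by
  obtain ⟨h1, h2⟩ := sublist_and_boundedByNeighbor_of_reflTransGen h.1
  exact ⟨List.pairwise_lt_range.sublist h1, fun i hi => by simpa using h1.subset hi, h2⟩


theorem BoundedByNeighbor.le_max {f : ℕ → ℤ} {n : ℕ} {I : List ℕ} (h : BoundedByNeighbor f n I)
    (hI : I.Pairwise (· < ·)) {i k : ℕ} (hi : i < n) (hk : k + 1 < I.length)
    (h₁ : I[k] ≤ i) (h₂ : i ≤ I[k + 1]) : f i ≤ max (f I[k]) (f I[k + 1]) := by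
  obtain ⟨a, ha, hfa, hai⟩ := h i hi
  obtain ⟨j, hj, rfl⟩ := List.getElem_of_mem ha
  rw [List.pairwise_iff_getElem] at hI
  have hk₁ : I[k] ∈ I := List.getElem_mem _
  have hk₂ : I[k + 1] ∈ I := List.getElem_mem _
  have hb : I[k] ≤ I[j] ∧ I[j] ≤ I[k + 1] := by
    rcases hai with ⟨h3, h4⟩ | ⟨h3, h4⟩
    · have := h4 _ hk₁; omega
    · have := h4 _ hk₂; omega
  have h5 : ¬ j < k := fun hlt => by have := hI j k hj (by omega) hlt; omega
  have h6 : ¬ k + 1 < j := fun hlt => by have := hI (k + 1) j hk hj hlt; omega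
  obtain rfl | rfl : j = k ∨ j = k + 1 := by omega
  · exact le_max_of_le_left hfa
  · exact le_max_of_le_right hfa

/-- At the two ends of the sequence this upper bound replaces the constancy of the merge matrix. -/
theorem BoundedByNeighbor.le_first {f : ℕ → ℤ} {n : ℕ} {I : List ℕ} (h : BoundedByNeighbor f n I)
    (hI : I.Pairwise (· < ·)) {i : ℕ} (hi : i < n) (h0 : 0 < I.length) (h₂ : i ≤ I[0]) :
    f i ≤ f I[0] := by
  obtain ⟨a, ha, hfa, hai⟩ := h i hi
  obtain ⟨j, hj, rfl⟩ := List.getElem_of_mem ha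
  rw [List.pairwise_iff_getElem] at hI
  have h5 : ¬ 0 < j := fun hlt => by
    have := hI 0 j h0 hj hlt
    rcases hai with ⟨h3, h4⟩ | ⟨h3, h4⟩
    · omega
    · have := h4 _ (List.getElem_mem h0); omega
  obtain rfl : j = 0 := by omega
  exact hfa

theorem BoundedByNeighbor.le_last {f : ℕ → ℤ} {n : ℕ} {I : List ℕ} (h : BoundedByNeighbor f n I)
    (hI : I.Pairwise (· < ·)) {i k : ℕ} (hi : i < n) (hk : k + 1 = I.length) (h₁ : I[k] ≤ i) :
    f i ≤ f I[k] := by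
  obtain ⟨a, ha, hfa, hai⟩ := h i hi
  obtain ⟨j, hj, rfl⟩ := List.getElem_of_mem ha
  rw [List.pairwise_iff_getElem] at hI
  have h5 : ¬ j < k := fun hlt => by
    have := hI j k hj (by omega) hlt
    rcases hai with ⟨h3, h4⟩ | ⟨h3, h4⟩
    · have := h4 I[k] (List.getElem_mem _); omega
    · omega
  obtain rfl : j = k := by omega
  exact hfa

/-! ### Filling in segments -/

/-- `LeadsTo x l y`: the list `l` continues a non-diagonal path from `x` to `y`. -/
inductive LeadsTo : ℕ × ℕ → List (ℕ × ℕ) → ℕ × ℕ → Prop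
  | nil (x : ℕ × ℕ) : LeadsTo x [] x
  | cons {x y z : ℕ × ℕ} {l : List (ℕ × ℕ)} :
      NonDiagStep x y → LeadsTo y l z → LeadsTo x (y :: l) z

namespace LeadsTo

theorem append {x y z : ℕ × ℕ} {l l' : List (ℕ × ℕ)} (h : LeadsTo x l y) (h' : LeadsTo y l' z) :
    LeadsTo x (l ++ l') z := by
  induction h with
  | nil => exact h'
  | cons hs _ ih => exact .cons hs (ih h')

theorem isChain {x y : ℕ × ℕ} {l : List (ℕ × ℕ)} (h : LeadsTo x l y) :
    List.IsChain NonDiagStep (x :: l) := by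
  induction h with
  | nil => simp
  | cons hs _ ih => exact List.isChain_cons_cons.2 ⟨hs, ih⟩

theorem exists_eq_append {x y : ℕ × ℕ} {l : List (ℕ × ℕ)} (h : LeadsTo x l y) :
    ∃ d, x :: l = d ++ [y] := by
  induction h with
  | nil x => exact ⟨[], rfl⟩
  | @cons x y z l _ _ ih =>
    obtain ⟨d, hd⟩ := ih
    exact ⟨x :: d, by rw [hd]; rfl⟩

theorem getLast? {x y : ℕ × ℕ} {l : List (ℕ × ℕ)} (h : LeadsTo x l y) :
    (x :: l).getLast? = some y := by
  obtain ⟨d, hd⟩ := h.exists_eq_append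
  simp [hd]

end LeadsTo

theorem leadsTo_column (i j k : ℕ) :
    LeadsTo (i, j) ((List.range' (i + 1) k).map fun a => (a, j)) (i + k, j) := by
  induction k generalizing i with
  | zero => exact .nil _
  | succ k ih =>
    rw [List.range'_succ, List.map_cons, show i + (k + 1) = i + 1 + k by omega]
    exact .cons (.inl rfl) (ih _)

theorem leadsTo_row (i j k : ℕ) :
    LeadsTo (i, j) ((List.range' (j + 1) k).map fun a => (i, a)) (i, j + k) := by
  induction k generalizing j with
  | zero => exact .nil _
  | succ k ih =>
    rw [List.range'_succ, List.map_cons, show j + (k + 1) = j + 1 + k by omega]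
    exact .cons (.inr rfl) (ih _)

theorem leadsTo_segment {x y : ℕ × ℕ} (h : x ≤ y) : LeadsTo x (segment x y) y := by
  obtain ⟨x₁, x₂⟩ := x
  obtain ⟨y₁, y₂⟩ := y
  obtain ⟨h₁, h₂⟩ := Prod.mk_le_mk.1 h
  have hc := leadsTo_column x₁ x₂ (y₁ - x₁)
  have hr := leadsTo_row y₁ x₂ (y₂ - x₂)
  rw [Nat.add_sub_cancel' h₁] at hc
  rw [Nat.add_sub_cancel' h₂] at hr
  exact hc.append hr

theorem mem_segment_bounds {x y z : ℕ × ℕ} (h : x ≤ y) (hz : z ∈ segment x y) :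
    x ≤ z ∧ z ≤ y := by
  obtain ⟨h₁, h₂⟩ := Prod.le_def.1 h
  simp only [segment, List.mem_append, List.mem_map, List.mem_range'_1] at hz
  rw [Prod.le_def, Prod.le_def]
  rcases hz with ⟨a, ha, rfl⟩ | ⟨a, ha, rfl⟩ <;> simp only <;> omega

/-- The interior of the segment is matched with `f x` or `f y`, whichever is larger. Keeping `f y`
at the head of the dominated list lets consecutive segments be glued. -/
theorem WalkDominates.prepend_leadsTo {f : ℕ × ℕ → ℤ} {x y : ℕ × ℕ} {l A : List (ℕ × ℕ)}
    {B : List ℤ} (hl : LeadsTo x l y) (hf : ∀ z ∈ l, f z ≤ max (f x) (f y))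
    (h : WalkDominates ((y :: A).map f) (f y :: B)) :
    WalkDominates ((x :: (l ++ A)).map f) (f x :: f y :: B) := by
  obtain ⟨d, hd⟩ := hl.exists_eq_append
  have hmem : ∀ z ∈ d, f z ≤ max (f x) (f y) := by
    intro z hz
    have : z ∈ x :: l := by rw [hd]; exact List.mem_append_left _ hz
    rcases List.mem_cons.1 this with rfl | hz
    · exact le_max_left _ _
    · exact hf z hz
  rw [← List.cons_append, hd, List.append_assoc, List.map_append]
  rcases le_total (f y) (f x) with hxy | hxy
  · refine .prepend_le (.right hxy h) ?_
    rw [max_eq_left hxy] at hmem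
    exact List.forall_mem_map.2 hmem
  · rw [max_eq_right hxy] at hmem
    cases d with
    | nil =>
      obtain rfl : x = y := by simpa using (List.cons.inj hd).1
      exact .right le_rfl h
    | cons w d =>
      obtain rfl : x = w := (List.cons.inj hd).1
      refine .both le_rfl (.prepend_le h ?_)
      exact List.forall_mem_map.2 fun z hz => hmem z (List.mem_cons_of_mem _ hz)

theorem WalkDominates.prepend_leadsTo_of_le {f : ℕ × ℕ → ℤ} {x y : ℕ × ℕ} {l A : List (ℕ × ℕ)}
    {B : List ℤ} (hl : LeadsTo x l y) (hf : ∀ z ∈ x :: l, f z ≤ f y)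
    (h : WalkDominates ((y :: A).map f) (f y :: B)) :
    WalkDominates ((x :: (l ++ A)).map f) (f y :: B) := by
  obtain ⟨d, hd⟩ := hl.exists_eq_append
  rw [hd] at hf
  rw [← List.cons_append, hd, List.append_assoc, List.map_append]
  refine .prepend_le h ?_
  exact List.forall_mem_map.2 fun z hz => hf z (List.mem_append_left _ hz)

theorem walkDominates_singleton {c : ℤ} {l : List ℤ} (hl : l ≠ []) (h : ∀ z ∈ l, z ≤ c) :
    WalkDominates l [c] := by
  obtain ⟨d, w, rfl⟩ := List.eq_nil_or_concat l |>.resolve_left hl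
  rw [List.concat_eq_append] at h ⊢
  exact .prepend_le (.both (h w (by simp)) .nil) fun z hz => h z (List.mem_append_left _ hz)

/-! ### Typical lifts -/

theorem alongPath_map_cons {r s : List ℤ} {I J : List ℕ} {x : ℕ × ℕ} (p : List (ℕ × ℕ))
    (h₁ : x.1 < I.length) (h₂ : x.2 < J.length) :
    alongPath (I.map fun i => r.getD i 0) (J.map fun j => s.getD j 0) (x :: p) =
      entry r s (I.getD x.1 0, J.getD x.2 0) ::
        alongPath (I.map fun i => r.getD i 0) (J.map fun j => s.getD j 0) p := by
  simp [alongPath, entry, h₁, h₂]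

theorem getD_le_pred {n : ℕ} {I : List ℕ} (h : ∀ i ∈ I, i < n) (k : ℕ) : I.getD k 0 ≤ n - 1 := by
  by_cases hk : k < I.length
  · rw [List.getD_eq_getElem _ _ hk]
    exact Nat.le_sub_one_of_lt (h _ (List.getElem_mem hk))
  · rw [List.getD_eq_default _ _ (not_lt.1 hk)]
    exact Nat.zero_le _

/-- Induction from the end of the path: the final stretch is matched with its first entry alone, and
each earlier segment is prepended by `WalkDominates.prepend_leadsTo`. -/
theorem lift_tail {r s : List ℤ} {I J : List ℕ} (hr : r ≠ []) (hs : s ≠ [])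
    (hI : IsTypicalIndices r I) (hJ : IsTypicalIndices s J) (hI0 : I ≠ []) (hJ0 : J ≠ []) :
    ∀ (p : List (ℕ × ℕ)) (x : ℕ × ℕ), List.IsChain NonDiagStep (x :: p) →
      (x :: p).getLast? = some (I.length - 1, J.length - 1) →
      (x.1 < I.length ∧ x.2 < J.length) ∧
        LeadsTo (I.getD x.1 0, J.getD x.2 0)
          (connect (I.getD x.1 0, J.getD x.2 0)
            (p.map (fun x => (I.getD x.1 0, J.getD x.2 0)) ++ [(r.length - 1, s.length - 1)]))
          (r.length - 1, s.length - 1) ∧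
        WalkDominates
          (((I.getD x.1 0, J.getD x.2 0) :: connect (I.getD x.1 0, J.getD x.2 0)
            (p.map (fun x => (I.getD x.1 0, J.getD x.2 0)) ++
              [(r.length - 1, s.length - 1)])).map (entry r s))
          (alongPath (I.map fun i => r.getD i 0) (J.map fun j => s.getD j 0) (x :: p)) := by
  obtain ⟨hIs, hIn, hIb⟩ := sublist_range_boundedByNeighbor r I hI
  obtain ⟨hJs, hJn, hJb⟩ := sublist_range_boundedByNeighbor s J hJ
  have hr' := List.length_pos_iff.2 hr
  have hs' := List.length_pos_iff.2 hs
  have hI' := List.length_pos_iff.2 hI0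
  have hJ' := List.length_pos_iff.2 hJ0
  intro p
  induction p with
  | nil =>
    intro x _ hl
    obtain rfl : x = (I.length - 1, J.length - 1) := by simpa using hl
    have h1 : I.length - 1 < I.length := by omega
    have h2 : J.length - 1 < J.length := by omega
    have hle : (I.getD (I.length - 1) 0, J.getD (J.length - 1) 0) ≤
        (r.length - 1, s.length - 1) :=
      Prod.mk_le_mk.2 ⟨getD_le_pred hIn _, getD_le_pred hJn _⟩
    refine ⟨⟨h1, h2⟩, ?_, ?_⟩
    · simpa [connect] using leadsTo_segment hle
    · rw [alongPath_map_cons [] h1 h2]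
      refine walkDominates_singleton (by simp) ?_
      simp only [List.map_nil, List.nil_append, connect, List.append_nil, List.map_cons,
        List.mem_cons, List.mem_map]
      rintro _ (rfl | ⟨z, hz, rfl⟩)
      · exact le_rfl
      obtain ⟨hz₁, hz₂⟩ := mem_segment_bounds hle hz
      rw [Prod.le_def] at hz₁ hz₂
      simp only [List.getD_eq_getElem _ _ h1, List.getD_eq_getElem _ _ h2] at hz₁ hz₂ ⊢
      exact add_le_add
        (hIb.le_last hIs (i := z.1) (by omega) (by omega) hz₁.1)
        (hJb.le_last hJs (i := z.2) (by omega) (by omega) hz₁.2)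
  | cons y p ih =>
    intro x hc hl
    rw [List.isChain_cons_cons] at hc
    rw [List.getLast?_cons_cons] at hl
    obtain ⟨⟨hy₁, hy₂⟩, hL, hD⟩ := ih y hc.2 hl
    have hx : x.1 < I.length ∧ x.2 < J.length := by
      rcases hc.1 with rfl | rfl <;> simp only at hy₁ hy₂ <;> omega
    have hle : (I.getD x.1 0, J.getD x.2 0) ≤ (I.getD y.1 0, J.getD y.2 0) := by
      rw [List.pairwise_iff_getElem] at hIs hJs
      rw [Prod.mk_le_mk, List.getD_eq_getElem _ _ hx.1, List.getD_eq_getElem _ _ hx.2,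
        List.getD_eq_getElem _ _ hy₁, List.getD_eq_getElem _ _ hy₂]
      rcases hc.1 with rfl | rfl
      · exact ⟨(hIs _ _ hx.1 hy₁ (by simp)).le, le_rfl⟩
      · exact ⟨le_rfl, (hJs _ _ hx.2 hy₂ (by simp)).le⟩
    refine ⟨hx, (leadsTo_segment hle).append hL, ?_⟩
    have hval : ∀ z ∈ segment (I.getD x.1 0, J.getD x.2 0) (I.getD y.1 0, J.getD y.2 0),
        entry r s z ≤ max (entry r s (I.getD x.1 0, J.getD x.2 0))
          (entry r s (I.getD y.1 0, J.getD y.2 0)) := by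
      intro z hz
      obtain ⟨hz₁, hz₂⟩ := mem_segment_bounds hle hz
      rw [Prod.le_def] at hz₁ hz₂
      simp only [List.getD_eq_getElem _ _ hx.1, List.getD_eq_getElem _ _ hx.2,
        List.getD_eq_getElem _ _ hy₁, List.getD_eq_getElem _ _ hy₂] at hz₁ hz₂ ⊢
      simp only [entry]
      -- One coordinate is constant on the segment, so the bound for the other sequence carries over
      -- to the sums.
      rcases hc.1 with rfl | rfl
      · obtain hz2 : z.2 = J[x.2] := le_antisymm hz₂.2 hz₁.2
        rw [hz2, max_add_add_right]
        have := hIn _ (List.getElem_mem hy₁)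
        exact add_le_add_left
          (hIb.le_max hIs (i := z.1) (hz₂.1.trans_lt this) hy₁ hz₁.1 hz₂.1) _
      · obtain hz1 : z.1 = I[x.1] := le_antisymm hz₂.1 hz₁.1
        rw [hz1, max_add_add_left]
        have := hJn _ (List.getElem_mem hy₂)
        exact add_le_add_right
          (hJb.le_max hJs (i := z.2) (hz₂.2.trans_lt this) hy₂ hz₁.2 hz₂.2) _
    rw [alongPath_map_cons _ hy₁ hy₂] at hD
    rw [alongPath_map_cons _ hx.1 hx.2, alongPath_map_cons _ hy₁ hy₂]
    exact .prepend_leadsTo (leadsTo_segment hle) hval hD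

theorem liftPath_spec {r s : List ℤ} {I J : List ℕ} {p : List (ℕ × ℕ)} (hr : r ≠ []) (hs : s ≠ [])
    (hI : IsTypicalIndices r I) (hJ : IsTypicalIndices s J)
    (hp : IsNonDiagPath I.length J.length p) :
    IsNonDiagPath r.length s.length (liftPath r.length s.length I J p) ∧
      WalkDominates (alongPath r s (liftPath r.length s.length I J p))
        (alongPath (I.map fun i => r.getD i 0) (J.map fun j => s.getD j 0) p) := by
  have hr' := List.length_pos_iff.2 hr
  have hs' := List.length_pos_iff.2 hs
  obtain ⟨p, rfl⟩ := hp.exists_eq_cons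
  obtain ⟨hI', hJ', _, hl, hc⟩ := hp
  obtain ⟨-, hL, hD⟩ := lift_tail hr hs hI hJ (List.length_pos_iff.1 hI')
    (List.length_pos_iff.1 hJ') p _ hc hl
  obtain ⟨hIs, hIn, hIb⟩ := sublist_range_boundedByNeighbor r I hI
  obtain ⟨hJs, hJn, hJb⟩ := sublist_range_boundedByNeighbor s J hJ
  have hle : ((0, 0) : ℕ × ℕ) ≤ (I.getD 0 0, J.getD 0 0) :=
    Prod.mk_le_mk.2 ⟨Nat.zero_le _, Nat.zero_le _⟩
  have hseg := leadsTo_segment hle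
  refine ⟨⟨hr', hs', rfl, (hseg.append hL).getLast?, (hseg.append hL).isChain⟩, ?_⟩
  rw [alongPath_map_cons _ hI' hJ'] at hD
  rw [alongPath_map_cons _ hI' hJ']
  refine .prepend_leadsTo_of_le hseg ?_ hD
  intro z hz
  have hz : z ≤ (I.getD 0 0, J.getD 0 0) := by
    rcases List.mem_cons.1 hz with rfl | hz
    · exact hle
    · exact (mem_segment_bounds hle hz).2
  rw [Prod.le_def] at hz
  have h1 := hIn _ (List.getElem_mem hI')
  have h2 := hJn _ (List.getElem_mem hJ')
  simp only [List.getD_eq_getElem _ _ hI', List.getD_eq_getElem _ _ hJ'] at hz ⊢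
  exact add_le_add (hIb.le_first hIs (i := z.1) (hz.1.trans_lt h1) hI' hz.1)
    (hJb.le_first hJs (i := z.2) (hz.2.trans_lt h2) hJ' hz.2)

/-- Every merge of two sequences is dominated by a merge of their typical sequences. -/
theorem exists_merge_typicalSeq {r s u v q : List ℤ} (hu : IsTypicalSeq r u)
    (hv : IsTypicalSeq s v) (hq : q ∈ merges r s) : ∃ q' ∈ merges u v, WalkDominates q' q := by
  obtain ⟨q₁, hq₁, hd₁⟩ := exists_walkMerge_of_mem_merges hq
  obtain ⟨q₂, hq₂, hd₂⟩ := (walkDominates_of_reflTransGen hu.1).exists_walkMerge hq₁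
  obtain ⟨q₃, hq₃, hd₃⟩ := (walkDominates_of_reflTransGen hv.1).exists_walkMerge hq₂.symm
  exact ⟨q₃, hq₃.symm.mem_merges, hd₃.trans (hd₂.trans hd₁)⟩

end MergeSeq

theorem mainTheorem9 (r s : List ℤ) (hr : r ≠ []) (hs : s ≠ [])
    (u v : List ℤ) (hu : MergeSeq.IsTypicalSeq r u) (hv : MergeSeq.IsTypicalSeq s v)
    (t : List ℤ) (ht : t ∈ MergeSeq.merges u v)
    (hdom : MergeSeq.DominatesSet t (MergeSeq.merges u v)) :
    (∃ L, MergeSeq.IsTypicalLift r s u v t L) ∧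
      ∀ L, MergeSeq.IsTypicalLift r s u v t L →
        L ∈ MergeSeq.nonDiagMerges r s ∧
          ∀ q ∈ MergeSeq.merges r s, MergeSeq.Dominates L q := by
  constructor
  · obtain ⟨I, hI, hIu⟩ := hu.exists_isTypicalIndices
    obtain ⟨J, hJ, hJv⟩ := hv.exists_isTypicalIndices
    -- `t` itself may repeat entries and step diagonally; a lift only needs a path whose entries
    -- dominate it.
    obtain ⟨q, hq, hqt⟩ := MergeSeq.exists_walkMerge_of_mem_merges ht
    obtain ⟨p, hp, hpq⟩ := hq.exists_isNonDiagPath (hu.ne_nil hr)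
    exact ⟨_, I, J, p, hI, hIu, hJ, hJv, hp,
      MergeSeq.dominates_iff_walkDominates.2 (hpq.trans hqt), rfl⟩
  · rintro L ⟨I, J, p, hI, rfl, hJ, rfl, hp, hpt, rfl⟩
    obtain ⟨hpath, hd⟩ := MergeSeq.liftPath_spec hr hs hI hJ (by simpa using hp)
    refine ⟨hpath.alongPath_mem_nonDiagMerges, fun q hq => ?_⟩
    obtain ⟨q', hq', hq'q⟩ := MergeSeq.exists_merge_typicalSeq hu hv hq
    rw [MergeSeq.dominates_iff_walkDominates] at hpt ⊢
    exact hd.trans (hpt.trans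
      ((MergeSeq.dominates_iff_walkDominates.1 (hdom q' hq')).trans hq'q))
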